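/- Let $[0,1]^d$ be the unit cube in $\mathbb{R}^d$. For $r,d\in\mathbb{N}=\{1,2,\dots\}$ let $\mathcal{C}^r_d$ be the class of all $r$ times continuously differentiable functions $f\colon[0,1]^d\to\mathbb{R}$ with $\|D^\beta f\|_\infty\le 1$ for all $\beta\in\mathbb{N}_0^d$ with $|\beta|\le r$. An algorithm using $n\in\mathbb{N}_0$ function values is a map $A=\varphi\circ N$, where $N(f)=(f(x_1),\dots,f(x_n))$, each point $x_i\in[0,1]^d$ may be chosen depending on the already computed values $f(x_1),\dots,f(x_{i-1})$, and $\varphi\colon\mathbb{R}^n\to L_\infty([0,1]^d)$ is an arbitrary map. Let $e(n,\mathcal{C}^r_d)$ be the infimum of the worst case errors $\sup_{f\in\mathcal{C}^r_d}\|f-A(f)\|_\infty$ over all algorithms $A$ using at most $n$ function values, and for $\varepsilon>0$ let $$n^{\rm app}(\varepsilon,\mathcal{C}^r_d)=\min\{n\in\mathbb{N}_0 \mid e(n,\mathcal{C}^r_d)\le\varepsilon\}.$$ **Theorem.** Let $r\in\mathbb{N}$ be even. Then there are positive constants $c_r$, $C_r$ and $\varepsilon_r$, depending only on $r$, such that $$\left(c_r\sqrt{d}\,\varepsilon^{-1/r}\right)^d\le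 n^{\rm app}(\varepsilon,\mathcal{C}^r_d)\le\left(C_r\sqrt{d}\,\varepsilon^{-1/r}\right)^d$$ for all $d\in\mathbb{N}$ and all $\varepsilon\in(0,\varepsilon_r)$. The upper bound holds for all $\varepsilon>0$. (In particular, $n^{\rm app}(\varepsilon,\mathcal{C}^r_d)$ is finite for all $\varepsilon>0$.) -/

import Mathlib

open MeasureTheory
open scoped ENNReal

noncomputable section

namespace UniformRecovery

/-- The closed unit cube `[0,1]^d` in `ℝ^d`. -/
def cube (d : ℕ) : Set (Fin d → ℝ) := Set.Icc 0 1

/-- The mixed partial derivative `∂^k f / ∂x_{j 0} ⋯ ∂x_{j (k-1)}` of a function on the unit cube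
(one-sided at boundary points, the derivative being taken within the cube). For `f` of class `C^r`
and `k ≤ r` the order of differentiation is irrelevant, and as `j` runs through all sequences of
length `k` these are exactly the `D^β f` with `|β| = k`. -/
def mixedPartial {d : ℕ} (f : (Fin d → ℝ) → ℝ) {k : ℕ} (j : Fin k → Fin d)
    (x : Fin d → ℝ) : ℝ :=
  iteratedFDerivWithin ℝ k f (cube d) x (fun i => Pi.single (j i) (1 : ℝ))

/-- The class `C^r_d` of functions that are `r` times continuously differentiable on `[0,1]^d` and
whose partial derivatives of all orders `k ≤ r` are bounded by one on `[0,1]^d`. Functions are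
represented by extensions to `ℝ^d`; the values outside of the cube play no role. -/
def smoothClass (r d : ℕ) : Set ((Fin d → ℝ) → ℝ) :=
  {f | ContDiffOn ℝ r f (cube d) ∧
    ∀ k ≤ r, ∀ j : Fin k → Fin d, ∀ x ∈ cube d, |mixedPartial f j x| ≤ 1}

/-- The space `L_∞([0,1]^d)`. -/
abbrev LInfty (d : ℕ) : Type := Lp ℝ ∞ (volume.restrict (cube d))

/-- The adaptive information `(f(x_1), …, f(x_n))`: the next point is computed by `node` from the
function values that are already known. -/
def information {d : ℕ} (node : ∀ i : ℕ, (Fin i → ℝ) → cube d) (f : (Fin d → ℝ) → ℝ) :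
    ∀ n : ℕ, Fin n → ℝ
  | 0 => Fin.elim0
  | n + 1 => Fin.snoc (α := fun _ => ℝ) (information node f n)
      (f (node n (information node f n)))

/-- A deterministic adaptive algorithm `A = φ ∘ N` using `n` function values. Only the first `n`
node selection rules are ever used. -/
structure Algorithm (d n : ℕ) where
  /-- The rule that selects the next sampling point from the known function values. -/
  node : ∀ i : ℕ, (Fin i → ℝ) → cube d
  /-- The arbitrary map that turns the information into an approximation. -/
  φ : (Fin n → ℝ) → LInfty d

/-- The output `A(f) = φ(N(f))` of the algorithm. -/
def Algorithm.output {d n : ℕ} (A : Algorithm d n) (f : (Fin d → ℝ) → ℝ) : LInfty d :=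
  A.φ (information A.node f n)

/-- The worst case error `sup_{f ∈ F} ‖f - A(f)‖_∞`. -/
def Algorithm.error {d n : ℕ} (A : Algorithm d n) (F : Set ((Fin d → ℝ) → ℝ)) : ℝ≥0∞ :=
  ⨆ f ∈ F, eLpNorm (fun x => f x - A.output f x) ∞ (volume.restrict (cube d))

/-- The minimal worst case error of algorithms that use at most `n` function values. -/
def minError {d : ℕ} (n : ℕ) (F : Set ((Fin d → ℝ) → ℝ)) : ℝ≥0∞ :=
  ⨅ (m : ℕ) (_ : m ≤ n) (A : Algorithm d m), A.error F

/-- The minimal number `n^app(ε, F)` of function values needed for uniform approximation on `F`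
up to the error `ε`; it is `⊤` if no number suffices. -/
def nApp {d : ℕ} (ε : ℝ) (F : Set ((Fin d → ℝ) → ℝ)) : ℕ∞ :=
  ⨅ (n : ℕ) (_ : minError n F ≤ ENNReal.ofReal ε), (n : ℕ∞)

end UniformRecovery

end

namespace UniformRecovery

/-! Upper bound: sample on the grid of mesh δ = 1/m and return any class member with these values.
By symmetry and convexity of the class, the error is at most twice the sup norm of a class member
vanishing on the grid. `exists_abs_mixedPartial_le` bounds that norm by A(dδ²)^(r/2). Along a grid
line, small values at grid points and a bounded high derivative force small second derivatives at
grid points, with a dimension-free constant. Inductively these second derivatives are small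
everywhere. Releasing the coordinates from the grid one at a time then adds only sup|∂ᵢ²|·δ² each,
because `abs_le_max_endpoints_add` has factor 1 in front of the maximum. So every two orders of
smoothness gain a factor dδ²; this is where evenness of r enters.

Lower bound: a Euclidean ball of radius ρ has volume at most (√(2πe)ρ/√d)^d, so too few balls around
the nodes leave a point y of the cube uncovered. A radial bump at y of height proportional to ρ^r
lies in the class, with constants independent of d. It vanishes at all nodes, so the data cannot
tell it from its negative. Take ρ proportional to ε^(1/r). -/

/-! ### Differentiation along coordinate lines -/

theorem uniqueDiffOn_cube (d : ℕ) : UniqueDiffOn ℝ (cube d) := by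
  refine uniqueDiffOn_convex (convex_Icc 0 1) ?_
  refine ⟨fun _ => 1 / 2, ?_⟩
  rw [cube, ← Set.pi_univ_Icc, interior_pi_set Set.finite_univ]
  simp only [interior_Icc, Set.mem_pi, Set.mem_Ioo]
  intro i _
  norm_num

theorem mem_cube_iff {d : ℕ} {x : Fin d → ℝ} : x ∈ cube d ↔ ∀ i, x i ∈ Set.Icc (0 : ℝ) 1 := by
  simp only [cube, Set.mem_Icc, Pi.le_def, Pi.zero_apply, Pi.one_apply, forall_and]

theorem update_mem_cube {d : ℕ} {x : Fin d → ℝ} (hx : x ∈ cube d) (i : Fin d) {t : ℝ}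
    (ht : t ∈ Set.Icc (0 : ℝ) 1) : Function.update x i t ∈ cube d := by
  rw [mem_cube_iff] at hx ⊢
  intro l
  by_cases h : l = i
  · subst h; simpa using ht
  · simpa [h] using hx l

theorem hasDerivWithinAt_mixedPartial {r d k : ℕ} {f : (Fin d → ℝ) → ℝ}
    (hf : ContDiffOn ℝ r f (cube d)) (hk : k < r) (j : Fin k → Fin d) (i : Fin d)
    {x : Fin d → ℝ} (hx : x ∈ cube d) {t : ℝ} (ht : t ∈ Set.Icc (0 : ℝ) 1) :
    HasDerivWithinAt (fun t => mixedPartial f j (Function.update x i t))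
      (mixedPartial f (Fin.cons i j : Fin (k + 1) → Fin d) (Function.update x i t))
      (Set.Icc 0 1) t := by
  have hy := update_mem_cube hx i ht
  have h1 := (hf.differentiableOn_iteratedFDerivWithin (m := k) (by exact_mod_cast hk)
    (uniqueDiffOn_cube d) _ hy).hasFDerivWithinAt
  have h2 : HasDerivWithinAt (Function.update x i) (Pi.single i (1 : ℝ)) (Set.Icc 0 1) t :=
    (hasDerivAt_update x i t).hasDerivWithinAt
  have h3 := h1.comp_hasDerivWithinAt t h2 (fun s hs => update_mem_cube hx i hs)
  have h4 := (ContinuousMultilinearMap.apply ℝ (fun _ : Fin k => (Fin d → ℝ)) ℝ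
    (fun l => Pi.single (j l) (1 : ℝ))).hasFDerivAt.comp_hasDerivWithinAt t h3
  exact h4

/-! ### One-dimensional Taylor estimates -/

/-- The remainder vanishes at x and its derivative is the remainder of one order less for the
shifted sequence, so the mean value inequality gives the induction. The factor 1/n! is given up. -/
theorem abs_sub_taylor_le {M : ℝ} : ∀ (n : ℕ) (u : ℕ → ℝ → ℝ)
    (_ : ∀ a < n, ∀ t ∈ Set.Icc (0 : ℝ) 1, HasDerivWithinAt (u a) (u (a + 1) t) (Set.Icc 0 1) t)
    (_ : ∀ t ∈ Set.Icc (0 : ℝ) 1, |u n t| ≤ M) {x t : ℝ} (_ : x ∈ Set.Icc (0 : ℝ) 1)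
    (_ : t ∈ Set.Icc (0 : ℝ) 1),
    |u 0 t - ∑ a ∈ Finset.range n, u a x * (t - x) ^ a / (a.factorial : ℝ)| ≤ M * |t - x| ^ n
  | 0, u, _, hM, x, t, hx, ht => by simpa using hM t ht
  | n + 1, u, hu, hM, x, t, hx, ht => by
    have ih : ∀ {y : ℝ}, y ∈ Set.Icc (0 : ℝ) 1 →
        |u 1 y - ∑ a ∈ Finset.range n, u (a + 1) x * (y - x) ^ a / (a.factorial : ℝ)|
          ≤ M * |y - x| ^ n := fun {y} hy =>
      abs_sub_taylor_le n (fun a => u (a + 1)) (fun a ha => hu (a + 1) (by omega)) hM hx hy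
    have hM0 : 0 ≤ M := (abs_nonneg _).trans (hM x hx)
    have hsub : Set.uIcc x t ⊆ Set.Icc (0 : ℝ) 1 := Set.uIcc_subset_Icc hx ht
    have hd : ∀ y ∈ Set.uIcc x t, HasDerivWithinAt
        (fun y => u 0 y - ∑ a ∈ Finset.range (n + 1), u a x * (y - x) ^ a / (a.factorial : ℝ))
        (u 1 y - ∑ a ∈ Finset.range n, u (a + 1) x * (y - x) ^ a / (a.factorial : ℝ))
        (Set.uIcc x t) y := by
      intro y hy
      refine ((hu 0 (by omega) y (hsub hy)).mono hsub).sub ?_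
      have h : ∀ a ∈ Finset.range (n + 1), HasDerivWithinAt
          (fun y => u a x * (y - x) ^ a / (a.factorial : ℝ))
          (u a x * (a * (y - x) ^ (a - 1)) / (a.factorial : ℝ)) (Set.uIcc x t) y := by
        intro a _
        have := (((hasDerivAt_id y).sub_const x).pow a).const_mul (u a x)
        have := this.div_const (a.factorial : ℝ)
        simpa using this.hasDerivWithinAt
      have := HasDerivWithinAt.fun_sum h
      convert this using 1
      rw [Finset.sum_range_succ']
      simp only [Nat.cast_zero, zero_mul, mul_zero, zero_div, add_zero, Nat.add_sub_cancel]
      refine Finset.sum_congr rfl fun a _ => ?_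
      rw [Nat.factorial_succ]
      have : (a.factorial : ℝ) ≠ 0 := by positivity
      push_cast
      field_simp
    have key := (convex_uIcc x t).norm_image_sub_le_of_norm_hasDerivWithin_le hd
      (C := M * |t - x| ^ n) (fun y hy => by
        refine (ih (hsub hy)).trans ?_
        have : |y - x| ≤ |t - x| := Set.abs_sub_left_of_mem_uIcc hy
        gcongr) Set.left_mem_uIcc Set.right_mem_uIcc
    have h0 : u 0 x - ∑ a ∈ Finset.range (n + 1), u a x * (x - x) ^ a / (a.factorial : ℝ) = 0 := by
      rw [Finset.sum_range_succ']
      simp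
    rw [h0, sub_zero, Real.norm_eq_abs, Real.norm_eq_abs] at key
    calc _ ≤ _ := key
      _ = _ := by ring

/-- Expand about t: the linear term has opposite signs at a and b, so one endpoint bounds u 0 t from
above and the other from below. -/
theorem abs_le_max_endpoints_add {M δ : ℝ} (u : ℕ → ℝ → ℝ)
    (hu : ∀ a < 2, ∀ t ∈ Set.Icc (0 : ℝ) 1, HasDerivWithinAt (u a) (u (a + 1) t) (Set.Icc 0 1) t)
    (hM : ∀ t ∈ Set.Icc (0 : ℝ) 1, |u 2 t| ≤ M) {a b t : ℝ} (ha : a ∈ Set.Icc (0 : ℝ) 1)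
    (hb : b ∈ Set.Icc (0 : ℝ) 1) (hat : a ≤ t) (htb : t ≤ b) (hab : b - a ≤ δ) :
    |u 0 t| ≤ max |u 0 a| |u 0 b| + M * δ ^ 2 := by
  have ht : t ∈ Set.Icc (0 : ℝ) 1 := ⟨ha.1.trans hat, htb.trans hb.2⟩
  have hM0 : 0 ≤ M := (abs_nonneg _).trans (hM a ha)
  have h1 := abs_sub_taylor_le 2 u hu hM ht ha
  have h2 := abs_sub_taylor_le 2 u hu hM ht hb
  simp only [Finset.sum_range_succ, Finset.range_zero, Finset.sum_empty, sq_abs, pow_zero,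
    mul_one, Nat.factorial_zero, Nat.cast_one, div_one, zero_add, pow_one,
    Nat.factorial_one] at h1 h2
  have h1' : M * (a - t) ^ 2 ≤ M * δ ^ 2 :=
    mul_le_mul_of_nonneg_left (by nlinarith) hM0
  have h2' : M * (b - t) ^ 2 ≤ M * δ ^ 2 :=
    mul_le_mul_of_nonneg_left (by nlinarith) hM0
  have m1 := le_max_left |u 0 a| |u 0 b|
  have m2 := le_max_right |u 0 a| |u 0 b|
  have a1 := abs_le.1 (le_refl |u 0 a|)
  have a2 := abs_le.1 (le_refl |u 0 b|)
  rw [abs_le] at h1 h2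
  rcases le_total 0 (u 1 t) with h | h
  · have p1 : u 1 t * (a - t) ≤ 0 := mul_nonpos_of_nonneg_of_nonpos h (by linarith)
    have p2 : 0 ≤ u 1 t * (b - t) := mul_nonneg h (by linarith)
    rw [abs_le]; constructor <;> linarith
  · have p1 : 0 ≤ u 1 t * (a - t) := mul_nonneg_of_nonpos_of_nonpos h (by linarith)
    have p2 : u 1 t * (b - t) ≤ 0 := mul_nonpos_of_nonpos_of_nonneg h (by linarith)
    rw [abs_le]; constructor <;> linarith

/-- A grid bound for a function and a bound for its derivative of order `s` on the unit interval
control the second derivative on the grid. -/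
theorem exists_abs_second_deriv_le (s : ℕ) (hs : 2 ≤ s) :
    ∃ K : ℝ, 0 ≤ K ∧ ∀ (m : ℕ) (_ : 2 * s ≤ m) (u : ℕ → ℝ → ℝ) (B : ℝ)
      (_ : ∀ a < s, ∀ t ∈ Set.Icc (0 : ℝ) 1,
        HasDerivWithinAt (u a) (u (a + 1) t) (Set.Icc 0 1) t)
      (_ : ∀ t ∈ Set.Icc (0 : ℝ) 1, |u s t| ≤ 1)
      (_ : ∀ k ≤ m, |u 0 (k / m)| ≤ B), ∀ k ≤ m,
      |u 2 (k / m)| * (1 / m : ℝ) ^ 2 ≤ K * (B + (1 / m : ℝ) ^ s) := by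
  have hgrid : ∀ {k m : ℕ}, 0 < m → k ≤ m → (k / m : ℝ) ∈ Set.Icc (0 : ℝ) 1 := by
    intro k m hm hk
    have : (k : ℝ) ≤ m := by exact_mod_cast hk
    exact ⟨by positivity, div_le_one_of_le₀ this (by positivity)⟩
  rcases hs.eq_or_lt with rfl | hs
  · refine ⟨1, zero_le_one, fun m hm u B _ h2 hB k hk => ?_⟩
    have hB0 : 0 ≤ B := (abs_nonneg _).trans (hB k hk)
    have h := h2 _ (hgrid (by omega) hk)
    have : |u 2 (k / m)| * (1 / m : ℝ) ^ 2 ≤ 1 * (1 / m : ℝ) ^ 2 := by gcongr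
    linarith
  -- By Taylor, values at s consecutive grid points are a Vandermonde matrix applied to the scaled
  -- Taylor coefficients, up to O(δ^s). Its inverse depends on s only.
  · set V : Matrix (Fin s) (Fin s) ℝ := Matrix.vandermonde (fun b : Fin s => ((b : ℕ) : ℝ)) with hV
    have hdet : IsUnit V.det := by
      rw [isUnit_iff_ne_zero, hV, Matrix.det_vandermonde_ne_zero_iff]
      intro a b h
      exact Fin.ext (Nat.cast_injective h)
    set two : Fin s := ⟨2, hs⟩
    have hs1 : (1 : ℝ) ≤ (s : ℝ) ^ s := one_le_pow₀ (by exact_mod_cast (by omega : 1 ≤ s))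
    refine ⟨2 * (∑ b, |V⁻¹ two b|) * (s : ℝ) ^ s, by positivity, ?_⟩
    intro m hm u B hu h1 hB k hk
    have hm0 : 0 < m := by omega
    have hmR : (0 : ℝ) < m := by exact_mod_cast hm0
    have hB0 : 0 ≤ B := (abs_nonneg _).trans (hB k hk)
    -- σ is the direction of the s points: if there is no room to the right of k, then 2 * s ≤ m
    -- leaves room to the left.
    obtain ⟨σ, hσ, hσg⟩ : ∃ σ : ℝ, |σ| = 1 ∧ ∀ b < s, ∃ l ≤ m,
        (k / m + σ * b * (1 / m) : ℝ) = l / m := by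
      by_cases h : k + s ≤ m
      · refine ⟨1, by simp, fun b hb => ⟨k + b, by omega, ?_⟩⟩
        push_cast; ring
      · refine ⟨-1, by simp, fun b hb => ⟨k - b, by omega, ?_⟩⟩
        rw [Nat.cast_sub (by omega)]; ring
    set x : ℝ := k / m with hx
    set δ : ℝ := 1 / m with hδ
    have hδ0 : 0 < δ := by positivity
    set c : Fin s → ℝ := fun a => u a x * (σ * δ) ^ (a : ℕ) / ((a : ℕ).factorial : ℝ) with hc
    have hval : ∀ b, |(V.mulVec c) b| ≤ (s : ℝ) ^ s * (B + δ ^ s) := by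
      intro b
      obtain ⟨l, hl, hlb⟩ := hσg b b.2
      have hT := abs_sub_taylor_le s u hu h1 (hgrid hm0 hk) (hgrid hm0 hl)
      rw [← hx, ← hlb] at hT
      have hsum : (V.mulVec c) b = ∑ a ∈ Finset.range s,
          u a x * (x + σ * (b : ℕ) * δ - x) ^ a / (a.factorial : ℝ) := by
        rw [Matrix.mulVec, dotProduct, Finset.sum_range]
        refine Finset.sum_congr rfl fun a _ => ?_
        rw [hV, Matrix.vandermonde_apply, hc, add_sub_cancel_left]
        simp only [mul_pow]
        ring
      rw [← hsum] at hT
      have hu0 := hB l hl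
      rw [← hlb] at hu0
      have e : |x + σ * (b : ℕ) * δ - x| = (b : ℕ) * δ := by
        rw [add_sub_cancel_left, abs_mul, abs_mul, hσ, one_mul, abs_of_pos hδ0, Nat.abs_cast]
      rw [e, one_mul] at hT
      have hb : ((b : ℕ) * δ) ^ s ≤ (s : ℝ) ^ s * δ ^ s := by
        rw [← mul_pow]
        have : ((b : ℕ) : ℝ) ≤ s := by exact_mod_cast b.2.le
        gcongr
      have hBs : B ≤ (s : ℝ) ^ s * B := le_mul_of_one_le_left hB0 hs1
      rw [abs_le] at hT hu0 ⊢
      constructor <;> nlinarith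
    have hinv : c two = (V⁻¹.mulVec (V.mulVec c)) two := by
      rw [Matrix.mulVec_mulVec, Matrix.nonsing_inv_mul _ hdet, Matrix.one_mulVec]
    have hc2 : |u 2 x| * δ ^ 2 = 2 * |c two| := by
      have : c two = u 2 x * (σ * δ) ^ 2 / 2 := by simp [hc, two]
      rw [this, abs_div, abs_mul, abs_pow, abs_mul, hσ, abs_of_pos hδ0]
      norm_num
      ring
    rw [hc2, hinv]
    have : |(V⁻¹.mulVec (V.mulVec c)) two| ≤
        ∑ b, |V⁻¹ two b| * ((s : ℝ) ^ s * (B + δ ^ s)) := by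
      rw [Matrix.mulVec, dotProduct]
      refine (Finset.abs_sum_le_sum_abs _ _).trans (Finset.sum_le_sum fun b _ => ?_)
      rw [abs_mul]
      gcongr
      exact hval b
    rw [← Finset.sum_mul] at this
    linarith

/-! ### From the grid to the whole cube -/

/-- Induction on the set of coordinates allowed off the grid; each newly freed coordinate costs an
additive M. -/
theorem abs_le_of_grid {d m : ℕ} (hm : 0 < m) {g : (Fin d → ℝ) → ℝ} {B M : ℝ}
    (hg : ∀ x ∈ cube d, ∀ i, ∀ a ∈ Set.Icc (0 : ℝ) 1, ∀ b ∈ Set.Icc (0 : ℝ) 1, ∀ t, a ≤ t → t ≤ b →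
      b - a ≤ 1 / m → |g (Function.update x i t)| ≤
        max |g (Function.update x i a)| |g (Function.update x i b)| + M)
    (hB : ∀ x ∈ cube d, (∀ i, ∃ k ≤ m, x i = (k / m : ℝ)) → |g x| ≤ B) :
    ∀ x ∈ cube d, |g x| ≤ B + d * M := by
  have hmR : (0 : ℝ) < m := by exact_mod_cast hm
  have key : ∀ S : Finset (Fin d), ∀ x ∈ cube d, (∀ i ∉ S, ∃ k ≤ m, x i = (k / m : ℝ)) →
      |g x| ≤ B + S.card * M := by
    intro S
    induction S using Finset.induction_on with
    | empty => intro x hx h; simpa using hB x hx (fun i => h i (by simp))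
    | insert i S hi ih =>
      intro x hx h
      have hxi := mem_cube_iff.1 hx i
      obtain ⟨k, hk, hk1, hk2⟩ : ∃ k : ℕ, k + 1 ≤ m ∧ (k / m : ℝ) ≤ x i ∧
          x i ≤ ((k + 1 : ℕ) / m : ℝ) := by
        -- At x i = 1 the floor would be m and its cell would leave the interval, so the last cell
        -- is used.
        rcases hxi.2.eq_or_lt with h1 | h1
        · refine ⟨m - 1, by omega, ?_, ?_⟩
          · rw [h1, div_le_one hmR]; exact_mod_cast Nat.sub_le m 1
          · rw [h1, Nat.sub_add_cancel hm, div_self hmR.ne']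
        · refine ⟨⌊x i * m⌋₊, ?_, ?_, ?_⟩
          · rw [Nat.succ_le_iff, Nat.floor_lt (by have := hxi.1; positivity)]
            nlinarith
          · rw [div_le_iff₀ hmR]
            exact Nat.floor_le (by have := hxi.1; positivity)
          · rw [le_div_iff₀ hmR]
            push_cast
            exact (Nat.lt_floor_add_one _).le
      have hgrid : ∀ l : ℕ, l ≤ m → (l / m : ℝ) ∈ Set.Icc (0 : ℝ) 1 := fun l hl =>
        ⟨by positivity, div_le_one_of_le₀ (by exact_mod_cast hl) hmR.le⟩
      have hend : ∀ l : ℕ, l ≤ m → |g (Function.update x i (l / m : ℝ))| ≤ B + S.card * M := by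
        intro l hl
        refine ih _ (update_mem_cube hx i (hgrid l hl)) fun i' hi' => ?_
        by_cases hii : i' = i
        · subst hii; exact ⟨l, hl, by simp⟩
        · simpa [hii] using h i' (by simp [hii, hi'])
      have := hg x hx i _ (hgrid k (by omega)) _ (hgrid (k + 1) hk) (x i) hk1 hk2
        (by push_cast; rw [← sub_div]; simp)
      rw [Function.update_eq_self] at this
      refine this.trans ?_
      rw [Finset.card_insert_of_notMem hi]
      have := max_le (hend k (by omega)) (hend (k + 1) hk)
      push_cast at this ⊢
      linarith
  intro x hx
  simpa using key Finset.univ x hx (by simp)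

/-- The multi-index sequence obtained by prepending `a` copies of the coordinate `i`. -/
def prependCopies {d k : ℕ} (i : Fin d) (j : Fin k → Fin d) : ∀ a : ℕ, Fin (k + a) → Fin d
  | 0 => j
  | a + 1 => (Fin.cons i (prependCopies i j a) : Fin (k + a + 1) → Fin d)

/-- Induction on q, with 2q the number of derivatives still available. The induction hypothesis is
applied to ∂ᵢ² of the given partial derivative. A does not depend on d, as each step costs a factor
dδ² and no more. -/
theorem exists_abs_mixedPartial_le (q : ℕ) : ∀ C : ℝ, 0 ≤ C → ∃ A : ℝ, 0 ≤ A ∧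
    ∀ (r d m k : ℕ) (_ : 1 ≤ d) (_ : 0 < m) (_ : 2 * r ≤ m) (_ : k + 2 * q = r)
      (f : (Fin d → ℝ) → ℝ) (_ : f ∈ smoothClass r d) (j : Fin k → Fin d)
      (_ : ∀ x ∈ cube d, (∀ i, ∃ l ≤ m, x i = (l / m : ℝ)) →
        |mixedPartial f j x| ≤ C * (1 / m : ℝ) ^ (2 * q)),
      ∀ x ∈ cube d, |mixedPartial f j x| ≤ A * (d * (1 / m : ℝ) ^ 2) ^ q := by
  induction q with
  | zero =>
    intro C hC
    refine ⟨1, zero_le_one, ?_⟩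
    intro r d m k _ _ _ hk f hf j _ x hx
    simpa using hf.2 k (by omega) j x hx
  | succ q ih =>
    intro C hC
    obtain ⟨K, hK, hK'⟩ := exists_abs_second_deriv_le (2 * (q + 1)) (by omega)
    obtain ⟨A, hA, hA'⟩ := ih (K * (C + 1)) (by positivity)
    refine ⟨C + A, by positivity, ?_⟩
    intro r d m k hd hm hrm hk f hf j hj
    have hmR : (0 : ℝ) < m := by exact_mod_cast hm
    have hd1 : (1 : ℝ) ≤ d := by exact_mod_cast hd
    set δ : ℝ := 1 / m with hδ
    have hδ0 : 0 < δ := by positivity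
    have hder : ∀ x ∈ cube d, ∀ i, ∀ a < 2 * (q + 1), ∀ t ∈ Set.Icc (0 : ℝ) 1,
        HasDerivWithinAt (fun t => mixedPartial f (prependCopies i j a) (Function.update x i t))
          (mixedPartial f (prependCopies i j (a + 1)) (Function.update x i t))
          (Set.Icc 0 1) t := fun x hx i a ha t ht =>
      hasDerivWithinAt_mixedPartial hf.1 (by omega) (prependCopies i j a) i hx ht
    have hbound : ∀ i, ∀ x ∈ cube d, |mixedPartial f (prependCopies i j 2) x| ≤
        A * (d * δ ^ 2) ^ q := by
      intro i
      refine hA' r d m (k + 2) hd hm hrm (by omega) f hf _ fun x hx hxg => ?_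
      obtain ⟨l, hl, hxl⟩ := hxg i
      -- On the line through the grid point x in direction i, all grid points of the line are grid
      -- points of the cube.
      have h := hK' m (by omega)
        (fun a t => mixedPartial f (prependCopies i j a) (Function.update x i t))
        (C * δ ^ (2 * (q + 1))) (hder x hx i)
        (fun t ht => hf.2 _ (by omega) _ _ (update_mem_cube hx i ht))
        (fun n hn => by
          refine hj _ (update_mem_cube hx i ⟨by positivity,
            div_le_one_of_le₀ (by exact_mod_cast hn) hmR.le⟩) fun i' => ?_
          by_cases hii : i' = i
          · subst hii; exact ⟨n, hn, by simp⟩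
          · simpa [hii] using hxg i') l hl
      rw [← hxl, Function.update_eq_self, ← hδ] at h
      have e : K * (C * δ ^ (2 * (q + 1)) + δ ^ (2 * (q + 1))) =
          K * (C + 1) * δ ^ (2 * q) * δ ^ 2 := by ring
      rw [e] at h
      exact le_of_mul_le_mul_right h (by positivity)
    have hfin := abs_le_of_grid hm (g := mixedPartial f j) (M := A * (d * δ ^ 2) ^ q * δ ^ 2)
      (fun x hx i a ha b hb t hat htb hab => abs_le_max_endpoints_add
        (fun a t => mixedPartial f (prependCopies i j a) (Function.update x i t))
        (fun a ha => hder x hx i a (by omega))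
        (fun t ht => hbound i _ (update_mem_cube hx i ht)) ha hb hat htb hab) hj
    intro x hx
    refine (hfin x hx).trans ?_
    have h1 : (δ ^ 2) ^ (q + 1) ≤ (d * δ ^ 2) ^ (q + 1) := by
      gcongr
      exact le_mul_of_one_le_left (by positivity) hd1
    have h2 := mul_le_mul_of_nonneg_left h1 hC
    rw [← pow_mul] at h2
    calc _ ≤ C * (d * δ ^ 2) ^ (q + 1) + d * (A * (d * δ ^ 2) ^ q * δ ^ 2) := by gcongr
      _ = _ := by ring

theorem mixedPartial_fin_zero {d : ℕ} (f : (Fin d → ℝ) → ℝ) (j : Fin 0 → Fin d) (x : Fin d → ℝ) :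
    mixedPartial f j x = f x := by
  simp [mixedPartial]

/-- A function of the class of even smoothness `r` that vanishes on the regular grid of mesh size
`1/m` is uniformly of order `(√d / m) ^ r`. -/
theorem exists_abs_le_of_vanishing_on_grid {r : ℕ} (hr : Even r) : ∃ A : ℝ, 0 ≤ A ∧
    ∀ (d m : ℕ) (_ : 1 ≤ d) (_ : 0 < m) (_ : 2 * r ≤ m) (f : (Fin d → ℝ) → ℝ)
      (_ : f ∈ smoothClass r d)
      (_ : ∀ x ∈ cube d, (∀ i, ∃ l ≤ m, x i = (l / m : ℝ)) → f x = 0),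
      ∀ x ∈ cube d, |f x| ≤ A * (√d / m) ^ r := by
  obtain ⟨q, hq⟩ := hr
  obtain ⟨A, hA, h⟩ := exists_abs_mixedPartial_le q 0 le_rfl
  refine ⟨A, hA, fun d m hd hm hrm f hf h0 x hx => ?_⟩
  have := h r d m 0 hd hm hrm (by omega) f hf Fin.elim0
    (fun x hx hxg => by rw [mixedPartial_fin_zero, h0 x hx hxg]; simp) x hx
  rw [mixedPartial_fin_zero] at this
  refine this.trans_eq ?_
  rw [hq, ← two_mul, pow_mul, div_pow √(d : ℝ), Real.sq_sqrt (by positivity)]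
  congr 2
  ring

/-! ### The interpolation algorithm and the upper bound -/

theorem information_apply {d : ℕ} (node : ∀ i : ℕ, (Fin i → ℝ) → cube d) (f : (Fin d → ℝ) → ℝ) :
    ∀ (n : ℕ) (i : Fin n), information node f n i = f (node i (information node f i))
  | 0, i => i.elim0
  | n + 1, i => by
    induction i using Fin.lastCases with
    | last => simp [information]
    | cast i => simpa [information] using information_apply node f n i

theorem memLp_top_of_mem_smoothClass {r d : ℕ} {f : (Fin d → ℝ) → ℝ} (hf : f ∈ smoothClass r d) :
    MemLp f ∞ (volume.restrict (cube d)) := by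
  have hms : MeasurableSet (cube d) := measurableSet_Icc
  refine memLp_top_of_bound (hf.1.continuousOn.aestronglyMeasurable hms) 1 ?_
  filter_upwards [ae_restrict_mem hms] with x hx
  have := hf.2 0 (by omega) Fin.elim0 x hx
  rwa [mixedPartial_fin_zero] at this

theorem half_sub_mem_smoothClass {r d : ℕ} {f g : (Fin d → ℝ) → ℝ} (hf : f ∈ smoothClass r d)
    (hg : g ∈ smoothClass r d) : ((1 / 2 : ℝ) • (f - g)) ∈ smoothClass r d := by
  refine ⟨contDiffOn_const.smul (hf.1.sub hg.1), fun k hk j x hx => ?_⟩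
  have hkr : ((k : ℕ) : WithTop ℕ∞) ≤ r := by exact_mod_cast hk
  have hU := uniqueDiffOn_cube d
  have e : mixedPartial ((1 / 2 : ℝ) • (f - g)) j x =
      1 / 2 * (mixedPartial f j x - mixedPartial g j x) := by
    unfold mixedPartial
    have hf' := ((hf.1 x hx).of_le hkr)
    have hg' := ((hg.1 x hx).of_le hkr)
    rw [iteratedFDerivWithin_const_smul_apply (f := f - g) (hf'.sub hg') hU hx,
      iteratedFDerivWithin_sub_apply hf' hg' hU hx]
    rfl
  have h1 := abs_le.1 (hf.2 k hk j x hx)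
  have h2 := abs_le.1 (hg.2 k hk j x hx)
  rw [e, abs_le]
  constructor <;> linarith [h1.1, h1.2, h2.1, h2.2]

theorem nApp_le_of_error_le {d n : ℕ} {F : Set ((Fin d → ℝ) → ℝ)} {ε : ℝ} (A : Algorithm d n)
    (hA : A.error F ≤ ENNReal.ofReal ε) : nApp ε F ≤ (n : ℕ∞) := by
  have h1 : minError n F ≤ A.error F := iInf₂_le_of_le n le_rfl (iInf_le _ A)
  exact iInf₂_le n (h1.trans hA)

/-- The zero output errs by at most 1. For ε < 1 one has ε^(-1/r) ≥ 1, so rounding the grid size can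
be absorbed in the constant. -/
theorem nApp_eq_zero {r d : ℕ} {ε : ℝ} (hε : 1 ≤ ε) : nApp ε (smoothClass r d) = 0 := by
  refine le_antisymm ?_ zero_le
  let A : Algorithm d 0 := ⟨fun _ _ => ⟨0, by simp [mem_cube_iff]⟩, fun _ => 0⟩
  have hA : A.error (smoothClass r d) ≤ ENNReal.ofReal ε := by
    refine iSup₂_le fun f hf => ?_
    rw [eLpNorm_exponent_top]
    refine eLpNormEssSup_le_of_ae_bound ?_
    filter_upwards [ae_restrict_mem (measurableSet_Icc : MeasurableSet (cube d)),
      Lp.coeFn_zero ℝ ∞ (volume.restrict (cube d))] with x hx h0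
    have h1 := hf.2 0 (by omega) Fin.elim0 x hx
    rw [mixedPartial_fin_zero] at h1
    have h2 : (A.output f : (Fin d → ℝ) → ℝ) x = 0 := h0
    rw [h2, sub_zero, Real.norm_eq_abs]
    exact h1.trans hε
  exact_mod_cast nApp_le_of_error_le A hA

/-- Sampling at finitely many points and returning an arbitrary element of the class that
interpolates the data. -/
theorem nApp_le_card {r d : ℕ} {ι : Type*} [Fintype ι] (p : ι → cube d) {ε : ℝ}
    (h : ∀ f ∈ smoothClass r d, (∀ i, f (p i) = 0) → ∀ x ∈ cube d, |f x| ≤ ε / 2) :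
    nApp ε (smoothClass r d) ≤ Fintype.card ι := by
  classical
  set N := Fintype.card ι
  let e := Fintype.equivFin ι
  let node : ∀ i : ℕ, (Fin i → ℝ) → cube d := fun i _ =>
    if hi : i < N then p (e.symm ⟨i, hi⟩) else ⟨0, by simp [mem_cube_iff]⟩
  let φ : (Fin N → ℝ) → LInfty d := fun v =>
    if hv : ∃ g ∈ smoothClass r d, information node g N = v then
      (memLp_top_of_mem_smoothClass hv.choose_spec.1).toLp else 0
  let A : Algorithm d N := ⟨node, φ⟩
  have hA : A.error (smoothClass r d) ≤ ENNReal.ofReal ε := by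
    refine iSup₂_le fun f hf => ?_
    have hv : ∃ g ∈ smoothClass r d, information node g N = information node f N := ⟨f, hf, rfl⟩
    obtain ⟨g, hg, hinfo, hout⟩ : ∃ g, ∃ hg : g ∈ smoothClass r d,
        information node g N = information node f N ∧
          A.output f = (memLp_top_of_mem_smoothClass hg).toLp :=
      ⟨_, hv.choose_spec.1, hv.choose_spec.2, dif_pos hv⟩
    rw [hout]
    -- f and its interpolant g share their data, so (f - g)/2 is a class member vanishing at the
    -- nodes.
    have hz : ∀ i, ((1 / 2 : ℝ) • (f - g)) (p i) = 0 := by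
      intro i
      have h1 := congrFun hinfo (e i)
      have hp : ∀ w, node (e i) w = p i := fun w => by
        have hi : (e i : ℕ) < N := (e i).2
        simp [node, hi]
      simp only [information_apply, hp] at h1
      simp [h1]
    have hle := h _ (half_sub_mem_smoothClass hf hg) hz
    rw [eLpNorm_exponent_top]
    refine eLpNormEssSup_le_of_ae_bound ?_
    filter_upwards [ae_restrict_mem (measurableSet_Icc : MeasurableSet (cube d)),
      (memLp_top_of_mem_smoothClass hg).coeFn_toLp] with x hx hgx
    rw [hgx, Real.norm_eq_abs]
    have := hle x hx
    simp only [Pi.smul_apply, Pi.sub_apply, smul_eq_mul, abs_mul] at this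
    norm_num at this
    linarith
  exact nApp_le_of_error_le A hA

theorem exists_nApp_le {r : ℕ} (hr : 0 < r) (hr_even : Even r) : ∃ C : ℝ, 0 < C ∧
    ∀ d : ℕ, 1 ≤ d → ∀ ε : ℝ, 0 < ε →
      (nApp ε (smoothClass r d) : ENNReal) ≤
        ENNReal.ofReal ((C * √(d : ℝ) * ε ^ (-1 / (r : ℝ))) ^ d) := by
  obtain ⟨A, hA, hvan⟩ := exists_abs_le_of_vanishing_on_grid hr_even
  have hrR : (0 : ℝ) < r := by exact_mod_cast hr
  -- The 1 gives K ≤ K^r, the 2A then gives A / K^r ≤ 1/2, and the 2r gives 2r ≤ m.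
  set K : ℝ := 1 + 2 * A + 2 * r with hK
  have hK1 : 1 ≤ K := by linarith
  -- The 2 absorbs the ceiling and the m + 1 grid points per axis.
  refine ⟨K + 2, by linarith, fun d hd ε hε => ?_⟩
  rcases le_or_gt 1 ε with h1 | h1
  · rw [nApp_eq_zero h1]; simp
  have hd1 : (1 : ℝ) ≤ √(d : ℝ) := by
    rw [Real.one_le_sqrt]; exact_mod_cast hd
  have hε1 : (1 : ℝ) ≤ ε ^ (-1 / (r : ℝ)) :=
    Real.one_le_rpow_of_pos_of_le_one_of_nonpos hε h1.le
      (div_nonpos_of_nonpos_of_nonneg (by norm_num) hrR.le)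
  set s : ℝ := ε ^ (-1 / (r : ℝ)) with hs
  have hsr : s ^ r = ε⁻¹ := by
    rw [hs, ← Real.rpow_natCast, ← Real.rpow_mul hε.le, div_mul_cancel₀ _ hrR.ne',
      Real.rpow_neg_one]
  have hP : 1 ≤ √(d : ℝ) * s := one_le_mul_of_one_le_of_one_le hd1 hε1
  set m : ℕ := ⌈K * (√(d : ℝ) * s)⌉₊ with hm
  have hmle : K * (√(d : ℝ) * s) ≤ m := Nat.le_ceil _
  have hKm : K ≤ m := (le_mul_of_one_le_right (by linarith) hP).trans hmle
  have hmR : (0 : ℝ) < m := by linarith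
  have hm0 : 0 < m := by exact_mod_cast hmR
  have hrm : 2 * r ≤ m := by
    have : (2 * r : ℝ) ≤ m := by linarith
    exact_mod_cast this
  have hmub : (m : ℝ) + 1 ≤ (K + 2) * √(d : ℝ) * s := by
    have := Nat.ceil_lt_add_one (a := K * (√(d : ℝ) * s)) (by positivity)
    rw [← hm] at this
    nlinarith
  have hmem : ∀ j : Fin d → Fin (m + 1), (fun i => ((j i : ℕ) / m : ℝ)) ∈ cube d := fun j => by
    rw [mem_cube_iff]
    intro i
    refine ⟨by positivity, div_le_one_of_le₀ ?_ hmR.le⟩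
    exact_mod_cast Nat.lt_succ_iff.1 (j i).2
  have hcard := nApp_le_card (r := r) (ε := ε)
    (fun j : Fin d → Fin (m + 1) => (⟨_, hmem j⟩ : cube d)) (fun f hf h0 x hx => by
      refine (hvan d m hd hm0 hrm f hf (fun y _ hy => ?_) x hx).trans ?_
      · choose l hl hyl using hy
        have : y = fun i => ((⟨l i, Nat.lt_succ_iff.2 (hl i)⟩ : Fin (m + 1)) : ℕ) / (m : ℝ) :=
          funext hyl
        rw [this]
        exact h0 (fun i => ⟨l i, Nat.lt_succ_iff.2 (hl i)⟩)
      · have hq : √(d : ℝ) / m ≤ 1 / (K * s) := by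
          rw [div_le_div_iff₀ hmR (by positivity)]
          linarith
        calc A * (√(d : ℝ) / m) ^ r ≤ A * (1 / (K * s)) ^ r := by gcongr
          _ = A / K ^ r * ε := by
            rw [div_pow, mul_pow, hsr, one_pow]
            field_simp
          _ ≤ 1 / 2 * ε := by
            refine mul_le_mul_of_nonneg_right ?_ hε.le
            rw [div_le_div_iff₀ (by positivity) two_pos]
            have : K ≤ K ^ r := le_self_pow₀ hK1 hr.ne'
            linarith
          _ = ε / 2 := by ring)
  have hcard' : (nApp ε (smoothClass r d) : ENNReal) ≤ (((m + 1) ^ d : ℕ) : ENNReal) := by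
    rw [← ENat.toENNReal_coe, ENat.toENNReal_le]
    simpa using hcard
  refine hcard'.trans ?_
  rw [ENNReal.natCast_le_ofReal (by positivity)]
  push_cast
  gcongr

/-! ### Bumps with dimension-free derivative bounds -/

/-- The radial bump of radius `ρ` centred at `y`. -/
noncomputable def bump {E : Type*} [NormedAddCommGroup E] (ρ : ℝ) (y z : E) : ℝ :=
  Real.smoothTransition (1 - (ρ ^ 2)⁻¹ * ‖z - y‖ ^ 2)

theorem bump_eq_zero {E : Type*} [NormedAddCommGroup E] {ρ : ℝ} (hρ : 0 < ρ) {y z : E} (h : ρ ≤ ‖z - y‖) : bump ρ y z = 0 := by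
  refine Real.smoothTransition.zero_of_nonpos ?_
  rw [sub_nonpos, inv_mul_eq_div, one_le_div (by positivity)]
  gcongr

theorem bump_self {E : Type*} [NormedAddCommGroup E] (ρ : ℝ) (y : E) : bump ρ y y = 1 := by
  simp [bump]

section Bump

variable {E : Type*} [NormedAddCommGroup E] [InnerProductSpace ℝ E]

theorem contDiff_scaled_norm_sq (ρ : ℝ) (y : E) {n : WithTop ℕ∞} :
    ContDiff ℝ n (fun z : E => (ρ ^ 2)⁻¹ * ‖z - y‖ ^ 2) :=
  contDiff_const.mul ((contDiff_id.sub contDiff_const).norm_sq ℝ)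

theorem contDiff_bump (ρ : ℝ) (y : E) {n : ℕ} : ContDiff ℝ n (bump ρ y) :=
  (Real.smoothTransition.contDiff (n := (n : ℕ∞))).comp
    (contDiff_const.sub (contDiff_scaled_norm_sq ρ y))

/-- The function is quadratic: two derivatives are explicit and the rest vanish, so the dimension of
E never appears. -/
theorem norm_iteratedFDeriv_scaled_norm_sq_le {ρ : ℝ} (hρ : 0 < ρ) {y z : E} (h : ‖z - y‖ ≤ ρ)
    {i : ℕ} (hi : 1 ≤ i) :
    ‖iteratedFDeriv ℝ i (fun z : E => (ρ ^ 2)⁻¹ * ‖z - y‖ ^ 2) z‖ ≤ (2 / ρ) ^ i := by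
  have hfd : fderiv ℝ (fun z : E => (ρ ^ 2)⁻¹ * ‖z - y‖ ^ 2) =
      fun z => (2 * (ρ ^ 2)⁻¹) • innerSL ℝ (z - y) := by
    ext1 z
    have h1 : HasFDerivAt (fun z : E => ‖z - y‖ ^ 2) (2 • innerSL ℝ (z - y)) z :=
      by
      have := (hasStrictFDerivAt_norm_sq (z - y)).hasFDerivAt.comp z ((hasFDerivAt_id z).sub_const y)
      rwa [ContinuousLinearMap.comp_id] at this
    rw [(h1.const_mul ((ρ ^ 2)⁻¹)).fderiv]
    ext v
    simp
    ring
  have hfd2 : fderiv ℝ (fun z : E => (2 * (ρ ^ 2)⁻¹) • innerSL ℝ (z - y)) =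
      fun _ => (2 * (ρ ^ 2)⁻¹) • innerSL ℝ := by
    ext1 z
    have h1 : HasFDerivAt (fun z : E => innerSL ℝ (z - y)) (innerSL ℝ) z :=
      by
      have := ((innerSL ℝ (E := E)).hasFDerivAt (x := z - y)).comp z ((hasFDerivAt_id z).sub_const y)
      rwa [ContinuousLinearMap.comp_id] at this
    exact (h1.const_smul (2 * (ρ ^ 2)⁻¹)).fderiv
  obtain ⟨i, rfl⟩ := Nat.exists_eq_add_of_le' hi
  rw [← norm_iteratedFDeriv_fderiv, hfd]
  rcases i with _ | i
  · rw [norm_iteratedFDeriv_zero, norm_smul, innerSL_apply_norm, Real.norm_of_nonneg (by positivity)]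
    calc 2 * (ρ ^ 2)⁻¹ * ‖z - y‖ ≤ 2 * (ρ ^ 2)⁻¹ * ρ := by gcongr
      _ = (2 / ρ) ^ (0 + 1) := by
        rw [zero_add, pow_one]
        field_simp
  · rw [← norm_iteratedFDeriv_fderiv, hfd2]
    rcases i with _ | i
    · rw [norm_iteratedFDeriv_zero, norm_smul, Real.norm_of_nonneg (by positivity)]
      have h1 : ‖innerSL ℝ (E := E)‖ ≤ 1 :=
        ContinuousLinearMap.opNorm_le_bound _ zero_le_one fun v => by
          rw [innerSL_apply_norm, one_mul]
      calc 2 * (ρ ^ 2)⁻¹ * ‖innerSL ℝ (E := E)‖ ≤ 2 * (ρ ^ 2)⁻¹ * 1 := by gcongr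
        _ ≤ 4 * (ρ ^ 2)⁻¹ := by have : 0 < (ρ ^ 2)⁻¹ := by positivity
                                linarith
        _ = (2 / ρ) ^ (0 + 1 + 1) := by rw [div_pow]; norm_num; ring
    · rw [iteratedFDeriv_succ_const]
      simp only [Pi.zero_apply, norm_zero]
      positivity

/-- The bump is a fixed function of one variable composed with the scaled squared norm. Inside the
ball only its derivatives on [0,1] matter; outside, the bump is locally zero. -/
theorem exists_norm_iteratedFDeriv_bump_le (r : ℕ) : ∃ K : ℝ, 1 ≤ K ∧
    ∀ (E : Type) [NormedAddCommGroup E] [InnerProductSpace ℝ E] (ρ : ℝ) (_ : 0 < ρ) (y z : E)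
      (k : ℕ) (_ : k ≤ r), ‖iteratedFDeriv ℝ k (bump ρ y) z‖ ≤ K * (2 / ρ) ^ k := by
  set H : ℝ → ℝ := fun t => Real.smoothTransition (1 - t) with hH
  have hHs : ∀ n : ℕ, ContDiff ℝ n H := fun n =>
    (Real.smoothTransition.contDiff (n := (n : ℕ∞))).comp (contDiff_const.sub contDiff_id)
  have hb : ∀ i : ℕ, ∃ C : ℝ, ∀ t ∈ Set.Icc (0 : ℝ) 1, ‖iteratedFDeriv ℝ i H t‖ ≤ C := fun i =>
    isCompact_Icc.exists_bound_of_continuousOn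
      ((hHs i).continuous_iteratedFDeriv le_rfl).continuousOn
  choose C hC using hb
  have hC0 : ∀ i, 0 ≤ C i := fun i => (norm_nonneg _).trans (hC i 0 (by simp))
  refine ⟨1 + r.factorial * ∑ i ∈ Finset.range (r + 1), C i,
    le_add_of_nonneg_right (mul_nonneg (by positivity) (Finset.sum_nonneg fun i _ => hC0 i)), ?_⟩
  intro E _ _ ρ hρ y z k hk
  have hS : 0 ≤ ∑ i ∈ Finset.range (r + 1), C i := Finset.sum_nonneg fun i _ => hC0 i
  rcases le_or_gt ‖z - y‖ ρ with h | h
  · have hQ : (ρ ^ 2)⁻¹ * ‖z - y‖ ^ 2 ∈ Set.Icc (0 : ℝ) 1 := by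
      refine ⟨by positivity, ?_⟩
      rw [inv_mul_eq_div, div_le_one (by positivity)]
      gcongr
    have := norm_iteratedFDeriv_comp_le (hHs r) (contDiff_scaled_norm_sq ρ y)
      (by exact_mod_cast hk) z (C := ∑ i ∈ Finset.range (r + 1), C i) (D := 2 / ρ)
      (fun i hi => (hC i _ hQ).trans
        (Finset.single_le_sum (f := C) (fun i _ => hC0 i) (Finset.mem_range.2 (by omega))))
      (fun i hi _ => norm_iteratedFDeriv_scaled_norm_sq_le hρ h hi)
    refine this.trans ?_
    have hf : (k.factorial : ℝ) ≤ r.factorial := by exact_mod_cast Nat.factorial_le hk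
    gcongr
    nlinarith
  · have hev : bump ρ y =ᶠ[nhds z] fun _ => 0 := by
      have : ∀ᶠ w in nhds z, ρ < ‖w - y‖ :=
        (continuous_id.sub continuous_const).norm.continuousAt.eventually_const_lt h
      filter_upwards [this] with w hw
      exact bump_eq_zero hρ hw.le
    rw [(hev.iteratedFDeriv ℝ k).eq_of_nhds]
    have : iteratedFDeriv ℝ k (fun _ : E => (0 : ℝ)) z = 0 := by
      rcases k with _ | k
      · ext; simp
      · rw [iteratedFDeriv_succ_const]; rfl
    rw [this, norm_zero]
    positivity

end Bump

/-- The Euclidean norm of a vector of coordinates. -/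
noncomputable def euclNorm {d : ℕ} (x : Fin d → ℝ) : ℝ := ‖(WithLp.toLp 2 x : EuclideanSpace ℝ (Fin d))‖

/-- The radial bump with respect to the Euclidean norm as a function of the coordinates. -/
noncomputable def euclBump {d : ℕ} (ρ : ℝ) (y x : Fin d → ℝ) : ℝ :=
  bump ρ (WithLp.toLp 2 y : EuclideanSpace ℝ (Fin d)) (WithLp.toLp 2 x)

theorem euclBump_eq_zero {d : ℕ} {ρ : ℝ} (hρ : 0 < ρ) {x y : Fin d → ℝ} (h : ρ ≤ euclNorm (x - y)) :
    euclBump ρ y x = 0 :=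
  bump_eq_zero hρ h

/-- Coordinate vectors have Euclidean norm 1, so operator norms bound mixed partials; ρ ≤ 1 lets ρ^r
absorb ρ^(-k) for k ≤ r. -/
theorem exists_smul_euclBump_mem_smoothClass (r : ℕ) : ∃ c : ℝ, 0 < c ∧
    ∀ (d : ℕ) (ρ : ℝ) (_ : 0 < ρ) (_ : ρ ≤ 1) (y : Fin d → ℝ) (σ : ℝ) (_ : |σ| ≤ 1),
      (fun x => σ * (c * ρ ^ r) * euclBump ρ y x) ∈ smoothClass r d := by
  obtain ⟨K, hK, hb⟩ := exists_norm_iteratedFDeriv_bump_le r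
  refine ⟨1 / (K * 2 ^ r), by positivity, fun d ρ hρ hρ1 y σ hσ => ?_⟩
  set L : (Fin d → ℝ) →L[ℝ] EuclideanSpace ℝ (Fin d) :=
    ((EuclideanSpace.equiv (Fin d) ℝ).symm : (Fin d → ℝ) →L[ℝ] EuclideanSpace ℝ (Fin d)) with hL
  set b : EuclideanSpace ℝ (Fin d) → ℝ := bump ρ (WithLp.toLp 2 y)
  have hcomp : euclBump ρ y = b ∘ L := rfl
  have hs : ∀ n : ℕ, ContDiff ℝ n (b ∘ L) := fun n => (contDiff_bump ρ _).comp L.contDiff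
  set a : ℝ := σ * (1 / (K * 2 ^ r) * ρ ^ r) with ha
  have hfun : (fun x => a * euclBump ρ y x) = a • (b ∘ L) := by
    rw [← hcomp]; rfl
  rw [hfun]
  refine ⟨((hs r).const_smul a).contDiffOn, fun k hk j x hx => ?_⟩
  unfold mixedPartial
  rw [iteratedFDerivWithin_eq_iteratedFDeriv (f := a • (b ∘ L)) (uniqueDiffOn_cube d)
    ((hs k).const_smul a).contDiffAt hx,
    iteratedFDeriv_const_smul_apply (hs k).contDiffAt,
    L.iteratedFDeriv_comp_right (contDiff_bump ρ _ (n := k)) x le_rfl]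
  rw [smul_apply, ContinuousMultilinearMap.compContinuousLinearMap_apply,
    smul_eq_mul, abs_mul]
  have h1 : ‖iteratedFDeriv ℝ k b (L x) (fun i => L (Pi.single (j i) 1))‖ ≤ K * (2 / ρ) ^ k := by
    refine (ContinuousMultilinearMap.le_opNorm _ _).trans ?_
    have : ∀ i, ‖L (Pi.single (j i) 1)‖ = 1 := fun i => by
      have : L (Pi.single (j i) 1) = EuclideanSpace.single (j i) (1 : ℝ) := rfl
      rw [this]; simp
    simp only [this, Finset.prod_const_one, mul_one]
    exact hb _ ρ hρ _ _ k hk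
  have h2 : |a| ≤ 1 / (K * 2 ^ r) * ρ ^ r := by
    rw [ha, abs_mul, abs_of_pos (by positivity : 0 < 1 / (K * 2 ^ r) * ρ ^ r)]
    exact mul_le_of_le_one_left (by positivity) hσ
  calc |a| * |_| ≤ (1 / (K * 2 ^ r) * ρ ^ r) * (K * (2 / ρ) ^ k) := by
        exact mul_le_mul h2 h1 (abs_nonneg _) (by positivity)
    _ = 2 ^ k / 2 ^ r * (ρ ^ r / ρ ^ k) := by rw [div_pow]; field_simp
    _ ≤ 1 * 1 := by
        gcongr
        · exact div_le_one_of_le₀ (pow_le_pow_right₀ one_le_two hk) (by positivity)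
        · exact div_le_one_of_le₀ (pow_le_pow_of_le_one hρ.le hρ1 hk) (by positivity)
    _ = 1 := one_mul 1

/-! ### Volume of Euclidean balls -/

/-- A weak Stirling bound: keep only t > x in the Gamma integral, where t^x ≥ x^x. -/
theorem rpow_mul_exp_neg_le_Gamma {x : ℝ} (hx : 0 < x) :
    x ^ x * Real.exp (-x) ≤ Real.Gamma (x + 1) := by
  rw [Real.Gamma_eq_integral (by linarith), add_sub_cancel_right]
  have hint : IntegrableOn (fun t : ℝ => Real.exp (-t) * t ^ x) (Set.Ioi 0) := by
    simpa using Real.GammaIntegral_convergent (s := x + 1) (by linarith)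
  have hsub : Set.Ioi x ⊆ Set.Ioi (0 : ℝ) := Set.Ioi_subset_Ioi hx.le
  calc x ^ x * Real.exp (-x) = ∫ t in Set.Ioi x, Real.exp (-t) * x ^ x := by
        rw [integral_mul_const, integral_exp_neg_Ioi, mul_comm]
    _ ≤ ∫ t in Set.Ioi x, Real.exp (-t) * t ^ x := by
        refine setIntegral_mono_on ((integrableOn_exp_neg_Ioi x).mul_const _) (hint.mono_set hsub)
          measurableSet_Ioi fun t ht => ?_
        have : x < t := ht
        gcongr
    _ ≤ _ := by
        refine setIntegral_mono_set hint ?_ hsub.eventuallyLE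
        filter_upwards [ae_restrict_mem measurableSet_Ioi] with t ht
        have : 0 < t := ht
        simp only [Pi.zero_apply]
        positivity

theorem volume_euclBall_le {d : ℕ} (hd : 1 ≤ d) (y : Fin d → ℝ) {ρ : ℝ} (hρ : 0 < ρ) :
    volume {x : Fin d → ℝ | euclNorm (x - y) < ρ} ≤
      ENNReal.ofReal ((√(2 * Real.pi * Real.exp 1) * ρ / √(d : ℝ)) ^ d) := by
  have : Nonempty (Fin d) := ⟨⟨0, hd⟩⟩
  have hdR : (0 : ℝ) < d := by exact_mod_cast hd
  have hpre : {x : Fin d → ℝ | euclNorm (x - y) < ρ} =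
      (WithLp.toLp 2 : (Fin d → ℝ) → EuclideanSpace ℝ (Fin d)) ⁻¹'
        Metric.ball (WithLp.toLp 2 y) ρ := by
    ext x
    simp [euclNorm, dist_eq_norm]
  rw [hpre, (PiLp.volume_preserving_toLp (Fin d)).measure_preimage
    measurableSet_ball.nullMeasurableSet, EuclideanSpace.volume_ball, Fintype.card_fin,
    ← ENNReal.ofReal_pow hρ.le, ← ENNReal.ofReal_mul (by positivity)]
  refine ENNReal.ofReal_le_ofReal ?_
  have hG := rpow_mul_exp_neg_le_Gamma (x := (d : ℝ) / 2) (by positivity)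
  have e : ((d : ℝ) / 2) ^ ((d : ℝ) / 2) * Real.exp (-((d : ℝ) / 2)) =
      (√((d : ℝ) / (2 * Real.exp 1))) ^ d := by
    rw [Real.sqrt_eq_rpow, ← Real.rpow_natCast, ← Real.rpow_mul (by positivity),
      ← div_div, Real.div_rpow (by positivity) (Real.exp_pos 1).le, Real.exp_neg, div_eq_mul_inv,
      ← Real.exp_mul]
    congr 2 <;> ring_nf
  rw [e] at hG
  have hpos : 0 < √((d : ℝ) / (2 * Real.exp 1)) := Real.sqrt_pos.2 (by positivity)
  calc ρ ^ d * (√Real.pi ^ d / Real.Gamma ((d : ℝ) / 2 + 1))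
      ≤ ρ ^ d * (√Real.pi ^ d / (√((d : ℝ) / (2 * Real.exp 1))) ^ d) := by gcongr
    _ = _ := by
      rw [← div_pow, ← mul_pow]
      congr 1
      rw [Real.sqrt_div hdR.le, show 2 * Real.pi * Real.exp 1 = Real.pi * (2 * Real.exp 1) by ring,
        Real.sqrt_mul Real.pi_pos.le]
      field_simp

/-- Union bound on volumes. The open cube is used so that y has a neighbourhood inside the cube. -/
theorem exists_mem_openCube_far {d n : ℕ} (p : Fin n → Fin d → ℝ) {ρ : ℝ} {v : ℝ≥0∞}
    (hv : ∀ i, volume {x : Fin d → ℝ | euclNorm (x - p i) < ρ} ≤ v) (hn : n * v < 1) :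
    ∃ y ∈ Set.pi Set.univ (fun _ : Fin d => Set.Ioo (0 : ℝ) 1), ∀ i, ρ ≤ euclNorm (p i - y) := by
  by_contra! h
  have hsub : Set.pi Set.univ (fun _ : Fin d => Set.Ioo (0 : ℝ) 1) ⊆
      ⋃ i, {x : Fin d → ℝ | euclNorm (x - p i) < ρ} := by
    intro y hy
    obtain ⟨i, hi⟩ := h y hy
    refine Set.mem_iUnion.2 ⟨i, ?_⟩
    simp only [euclNorm, WithLp.toLp_sub, Set.mem_ofPred_eq] at hi ⊢
    rwa [norm_sub_rev]
  have h1 : volume (Set.pi Set.univ (fun _ : Fin d => Set.Ioo (0 : ℝ) 1)) = 1 := by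
    simp [Real.volume_pi_Ioo]
  have h2 := (measure_mono (μ := volume) hsub).trans (measure_iUnion_fintype_le _ _)
  rw [h1] at h2
  have h3 : ∑ i, volume {x : Fin d → ℝ | euclNorm (x - p i) < ρ} ≤ n * v :=
    (Finset.sum_le_sum fun i _ => hv i).trans (by simp)
  exact absurd (h2.trans h3) hn.not_ge

/-! ### Fooling functions and the lower bound -/

theorem information_eq_of_eq_at_nodes {d : ℕ} (node : ∀ i : ℕ, (Fin i → ℝ) → cube d)
    {f g : (Fin d → ℝ) → ℝ} : ∀ {n : ℕ}
    (_ : ∀ i < n, f (node i (information node g i)) = g (node i (information node g i))),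
    information node f n = information node g n
  | 0, _ => rfl
  | n + 1, h => by
    have ih := information_eq_of_eq_at_nodes node (fun i hi => h i (Nat.lt_succ_of_lt hi))
    simp only [information, ih, h n (Nat.lt_succ_self n)]

/-- f and -f yield the data of 0, hence one common output. An error of at most η for both would
force f ≤ η almost everywhere, yet f > η on a nonempty open subset of the cube. -/
theorem Algorithm.lt_error {d n : ℕ} (A : Algorithm d n) {F : Set ((Fin d → ℝ) → ℝ)}
    {f : (Fin d → ℝ) → ℝ} (hf : f ∈ F) (hf' : -f ∈ F) (hc : Continuous f)
    (h0 : ∀ i < n, f (A.node i (information A.node 0 i)) = 0) {y : Fin d → ℝ}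
    (hy : y ∈ Set.pi Set.univ (fun _ : Fin d => Set.Ioo (0 : ℝ) 1)) {η : ℝ} (hη : η < f y)
    (hη0 : 0 ≤ η) : ENNReal.ofReal η < A.error F := by
  by_contra! hle
  have hi : information A.node f n = information A.node 0 n :=
    information_eq_of_eq_at_nodes _ fun i hi => by simpa using h0 i hi
  have hi' : information A.node (-f) n = information A.node 0 n :=
    information_eq_of_eq_at_nodes _ fun i hi => by simpa using h0 i hi
  have hout : A.output (-f) = A.output f := by rw [Algorithm.output, Algorithm.output, hi, hi']
  have hae : ∀ g ∈ F, ∀ᵐ x ∂(volume.restrict (cube d)), |g x - A.output g x| ≤ η := by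
    intro g hg
    have h1 : eLpNorm (fun x => g x - A.output g x) ∞ (volume.restrict (cube d)) ≤
        ENNReal.ofReal η := (le_iSup₂ (f := fun (f : (Fin d → ℝ) → ℝ) (_ : f ∈ F) =>
          eLpNorm (fun x => f x - A.output f x) ∞ (volume.restrict (cube d))) g hg).trans hle
    rw [eLpNorm_exponent_top] at h1
    filter_upwards [ae_le_eLpNormEssSup (f := fun x => g x - A.output g x)
      (μ := volume.restrict (cube d))] with x hx
    have := hx.trans h1
    rwa [Real.enorm_eq_ofReal_abs, ENNReal.ofReal_le_ofReal_iff hη0] at this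
  have hle' : ∀ᵐ x ∂(volume.restrict (cube d)), f x ≤ η := by
    have h2 := hae (-f) hf'
    rw [hout] at h2
    filter_upwards [hae f hf, h2] with x h1 h2
    rw [abs_le] at h1 h2
    simp only [Pi.neg_apply] at h2
    linarith [h1.2, h2.1]
  set U : Set (Fin d → ℝ) := {x | η < f x} ∩ Set.pi Set.univ (fun _ : Fin d => Set.Ioo (0 : ℝ) 1)
  have hUo : IsOpen U := (isOpen_lt continuous_const hc).inter
    (isOpen_set_pi Set.finite_univ fun _ _ => isOpen_Ioo)
  have hpos : 0 < volume U := hUo.measure_pos volume ⟨y, hη, hy⟩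
  have hms : MeasurableSet (cube d) := measurableSet_Icc
  rw [ae_restrict_iff' hms, ae_iff] at hle'
  refine hpos.ne' (measure_mono_null (fun x hx => ?_) hle')
  simp only [Set.mem_ofPred_eq, not_forall, not_le]
  exact ⟨mem_cube_iff.2 fun i => Set.Ioo_subset_Icc_self (hx.2 i trivial), hx.1⟩

theorem exists_le_nApp {r : ℕ} (hr : 0 < r) : ∃ c ε₀ : ℝ, 0 < c ∧ 0 < ε₀ ∧
    ∀ d : ℕ, 1 ≤ d → ∀ ε : ℝ, 0 < ε → ε < ε₀ →
      ENNReal.ofReal ((c * √(d : ℝ) * ε ^ (-1 / (r : ℝ))) ^ d) ≤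
        (nApp ε (smoothClass r d) : ENNReal) := by
  obtain ⟨a, ha, hmem⟩ := exists_smul_euclBump_mem_smoothClass r
  have hrR : (0 : ℝ) < r := by exact_mod_cast hr
  set κ : ℝ := √(2 * Real.pi * Real.exp 1) with hκ
  have hκ0 : 0 < κ := Real.sqrt_pos.2 (by positivity)
  set τ : ℝ := (3 / a) ^ (1 / (r : ℝ)) with hτ
  have hτ0 : 0 < τ := by positivity
  have hτr : τ ^ r = 3 / a := by
    rw [hτ, ← Real.rpow_natCast, ← Real.rpow_mul (by positivity), one_div_mul_cancel hrR.ne',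
      Real.rpow_one]
  -- τ is chosen so that the bump height a * ρ ^ r is 3ε; ε < a / 3 then means ρ ≤ 1. The constant 1
  -- / (κ * τ) makes the claimed count times the ball volume bound equal to 1.
  refine ⟨1 / (κ * τ), a / 3, by positivity, by positivity, fun d hd ε hε hε1 => ?_⟩
  have hdR : (0 : ℝ) < √(d : ℝ) := Real.sqrt_pos.2 (by exact_mod_cast hd)
  set s : ℝ := ε ^ (-1 / (r : ℝ)) with hs
  have hs0 : 0 < s := by positivity
  have hsr : s ^ r = ε⁻¹ := by
    rw [hs, ← Real.rpow_natCast, ← Real.rpow_mul hε.le, div_mul_cancel₀ _ hrR.ne',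
      Real.rpow_neg_one]
  set ρ : ℝ := τ / s with hρ
  have hρ0 : 0 < ρ := by positivity
  have hρr : a * ρ ^ r = 3 * ε := by
    rw [hρ, div_pow, hτr, hsr]
    field_simp
  have hρ1 : ρ ≤ 1 := by
    by_contra! h
    have : 1 < ρ ^ r := one_lt_pow₀ h hr.ne'
    nlinarith
  have hbound : ∀ n : ℕ, minError n (smoothClass r d) ≤ ENNReal.ofReal ε →
      ENNReal.ofReal ((1 / (κ * τ) * √(d : ℝ) * s) ^ d) ≤ n := by
    intro n hn
    by_contra! hlt
    -- The level 2ε lies strictly between ε and the height 3ε, so the infimum over algorithms still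
    -- exceeds ε.
    refine hn.not_gt (lt_of_lt_of_le
      ((ENNReal.ofReal_lt_ofReal_iff (by positivity)).2 (by linarith : ε < 2 * ε)) ?_)
    refine le_iInf₂ fun m hm => le_iInf fun A => ?_
    have hvol : (m : ℝ≥0∞) * ENNReal.ofReal ((κ * ρ / √(d : ℝ)) ^ d) < 1 := by
      have hm' : (m : ℝ≥0∞) < ENNReal.ofReal ((1 / (κ * τ) * √(d : ℝ) * s) ^ d) :=
        lt_of_le_of_lt (by exact_mod_cast hm) hlt
      calc (m : ℝ≥0∞) * ENNReal.ofReal ((κ * ρ / √(d : ℝ)) ^ d)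
          < ENNReal.ofReal ((1 / (κ * τ) * √(d : ℝ) * s) ^ d) *
              ENNReal.ofReal ((κ * ρ / √(d : ℝ)) ^ d) :=
            ENNReal.mul_lt_mul_left (by
              rw [Ne, ENNReal.ofReal_eq_zero, not_le]; positivity) ENNReal.ofReal_ne_top hm'
        _ = 1 := by
          rw [← ENNReal.ofReal_mul (by positivity), ← mul_pow]
          have : 1 / (κ * τ) * √(d : ℝ) * s * (κ * ρ / √(d : ℝ)) = 1 := by
            rw [hρ]; field_simp
          rw [this, one_pow, ENNReal.ofReal_one]
    obtain ⟨y, hy, hfar⟩ := exists_mem_openCube_far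
      (fun i : Fin m => (A.node i (information A.node 0 i) : Fin d → ℝ))
      (fun i => volume_euclBall_le hd _ hρ0) hvol
    have hf := hmem d ρ hρ0 hρ1 y 1 (by simp)
    have hf' := hmem d ρ hρ0 hρ1 y (-1) (by simp)
    have hb : Continuous (euclBump ρ y) :=
      (contDiff_bump ρ _ (n := 0)).continuous.comp (PiLp.continuous_toLp 2 _)
    refine (A.lt_error hf ?_ (continuous_const.mul hb) (fun i hi => ?_) hy ?_
      (by positivity)).le
    · convert hf' using 1
      ext x
      simp
    · rw [euclBump_eq_zero hρ0 (hfar ⟨i, hi⟩), mul_zero]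
    · have : euclBump ρ y y = 1 := bump_self ρ _
      rw [this, one_mul, mul_one, hρr]
      linarith
  have : ((nApp ε (smoothClass r d) : ℕ∞) : ℝ≥0∞) =
      ⨅ (n : ℕ) (_ : minError n (smoothClass r d) ≤ ENNReal.ofReal ε), (n : ℝ≥0∞) := by
    simp [nApp, ENat.toENNReal_iInf]
  rw [this]
  exact le_iInf₂ hbound

end UniformRecovery

theorem theorem1 (r : ℕ) (hr : 0 < r) (hr_even : Even r) :
    ∃ c C ε₀ : ℝ, 0 < c ∧ 0 < C ∧ 0 < ε₀ ∧
      ∀ d : ℕ, 1 ≤ d →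
        (∀ ε : ℝ, 0 < ε → ε < ε₀ →
          ENNReal.ofReal ((c * √(d : ℝ) * ε ^ (-1 / (r : ℝ))) ^ d) ≤
            (UniformRecovery.nApp ε (UniformRecovery.smoothClass r d) : ENNReal)) ∧
        (∀ ε : ℝ, 0 < ε →
          (UniformRecovery.nApp ε (UniformRecovery.smoothClass r d) : ENNReal) ≤
            ENNReal.ofReal ((C * √(d : ℝ) * ε ^ (-1 / (r : ℝ))) ^ d)) := by
  obtain ⟨C, hC, hupper⟩ := UniformRecovery.exists_nApp_le hr hr_even
  obtain ⟨c, ε₀, hc, hε₀, hlower⟩ := UniformRecovery.exists_le_nApp hr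
  exact ⟨c, C, ε₀, hc, hC, hε₀, fun d hd => ⟨hlower d hd, hupper d hd⟩⟩
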